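/- Let $n\ge 0$ and let $X\subset\mathbb{R}^n$ be a closed convex set with nonempty interior (possibly unbounded). For $r>0$ let $e_r(X)=X\setminus\bigcup_{y\in\mathbb{R}^n\setminus X}B(y,r)$ be the erosion of $X$ by the radius $r$, where $B(y,r)$ is the open ball of radius $r$ about $y$. A similarity transformation $\sigma$ of $\mathbb{R}^n$ is called distance-increasing if $|\sigma(x)-\sigma(y)|>|x-y|$ for all $x\ne y$. A closed half-space $H\supset X$ is a supporting half-space of $X$ at a point $x\in\partial X$ if $x\in\partial H$; a point $x\in\partial X$ is regular if $X$ has exactly one supporting half-space at $x$; and a supporting half-space is regular if it supports $X$ at at least one regular point. A ball of radius $R>0$ centered at $p$ is exscribed to $X$ if every regular supporting half-space of $X$ is at distance $R$ from $p$ (so that $p$ lies outside all of them). Then there exist $r>0$ and a distance-increasing similarity transformation $\sigma$ of $\mathbb{R}^n$ with $e_r(X)=\sigma(X)$ if and only if $X$ has an exscribed ball. Moreover, whenever $r>0$ and $\sigma$ is a distance-increasing similarity transformation with $e_r(X)=\sigma(X)$, the map $\sigma$ has a unique fixed point $p$, this point lies outside every supporting half-space of $X$, and $X$ has an exscribed ball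 centered at $p$. -/

import Mathlib

namespace ErosionResilient

/-- Euclidean space `ℝⁿ`. -/
abbrev E (n : ℕ) : Type := EuclideanSpace ℝ (Fin n)

variable {n : ℕ}

/-- The erosion `e_r(X)`: remove from `X` all open balls of radius `r` centred at points of the
complement of `X`. -/
def erosion (r : ℝ) (X : Set (E n)) : Set (E n) :=
  X \ ⋃ y ∈ Xᶜ, Metric.ball y r

/-- A similarity transformation is distance-increasing if it strictly increases the distance of
any two distinct points (for `n ≥ 1`: its scaling factor is greater than `1`). -/
def DistanceIncreasing (σ : E n ≃ᵈ E n) : Prop :=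
  ∀ x y : E n, x ≠ y → dist x y < dist (σ x) (σ y)

/-- `H` is a closed half-space of `ℝⁿ`. -/
def IsClosedHalfSpace (H : Set (E n)) : Prop :=
  ∃ (u : E n) (c : ℝ), u ≠ 0 ∧ H = {x | inner ℝ u x ≤ c}

/-- `H` is a supporting half-space of `X` at the boundary point `x`. -/
def IsSupportingAt (X H : Set (E n)) (x : E n) : Prop :=
  IsClosedHalfSpace H ∧ X ⊆ H ∧ x ∈ frontier X ∧ x ∈ frontier H

/-- `H` is a supporting half-space of `X` (at some boundary point). -/
def IsSupporting (X H : Set (E n)) : Prop :=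
  ∃ x, IsSupportingAt X H x

/-- `x` is a regular boundary point of `X`: exactly one half-space supports `X` at `x`. -/
def IsRegularPoint (X : Set (E n)) (x : E n) : Prop :=
  x ∈ frontier X ∧ ∃! H : Set (E n), IsSupportingAt X H x

/-- `H` is a regular supporting half-space of `X`: it supports `X` at some regular point. -/
def IsRegularSupporting (X H : Set (E n)) : Prop :=
  ∃ x, IsRegularPoint X x ∧ IsSupportingAt X H x

/-- The ball of radius `R > 0` about `p` is exscribed to `X`: all regular supporting half-spaces
of `X` are at distance `R` from `p` (so `p` lies outside all of them). -/
def IsExscribedBall (X : Set (E n)) (p : E n) (R : ℝ) : Prop :=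
  0 < R ∧ ∀ H : Set (E n), IsRegularSupporting X H → Metric.infDist p H = R

/-- `X` has an exscribed ball. -/
def HasExscribedBall (X : Set (E n)) : Prop :=
  ∃ (p : E n) (R : ℝ), IsExscribedBall X p R

end ErosionResilient

namespace ErosionResilient

variable {n : ℕ}

/-! `X` is the intersection of its regular supporting half-spaces
(`mem_iff_forall_isRegularSupporting`). If all of them lie at distance `R` from `p`, doubling about
`p` moves each inwards by `R`, so it maps `X` onto its erosion by `R`.

Conversely, let `σ` have ratio `l > 1` and fixed point `p`, and put `R = r / (l - 1)`, the fixed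
value of `d ↦ l * d - r`. Iterating `σ` on a support point, together with recurrence of the
rotational part, gives distance at least `R` from `p` to every supporting half-space. Applying `σ`
and then undoing the erosion sends a regular supporting half-space at distance `d` to one at
distance `l * d - r`. An excess over `R` would grow geometrically, yet distances are bounded because
every half-space contains `X`. -/

/-- The closed half-space `{x | ⟪u, x⟫ ≤ c}`. -/
def halfSpace (u : E n) (c : ℝ) : Set (E n) := {x | inner ℝ u x ≤ c}

theorem mem_halfSpace {u x : E n} {c : ℝ} : x ∈ halfSpace u c ↔ inner ℝ u x ≤ c := Iff.rfl

theorem isClosedHalfSpace_halfSpace {u : E n} (hu : u ≠ 0) (c : ℝ) :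
    IsClosedHalfSpace (halfSpace u c) := ⟨u, c, hu, rfl⟩

theorem mem_frontier_halfSpace {u : E n} (hu : u ≠ 0) {c : ℝ} {x : E n} :
    x ∈ frontier (halfSpace u c) ↔ inner ℝ u x = c := by
  have hsurj : Function.Surjective (innerSL ℝ u) := by
    intro t
    refine ⟨(t / inner ℝ u u) • u, ?_⟩
    have : inner ℝ u u ≠ (0 : ℝ) := inner_self_ne_zero.mpr hu
    rw [innerSL_apply_apply, inner_smul_right]
    field_simp
  have hopen : IsOpenMap (innerSL ℝ u) := (innerSL ℝ u).isOpenMap hsurj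
  have h := hopen.preimage_frontier_eq_frontier_preimage (innerSL ℝ u).continuous (Set.Iic c)
  rw [frontier_Iic] at h
  have h2 : (innerSL ℝ u) ⁻¹' Set.Iic c = halfSpace u c := by
    ext y; simp [halfSpace]
  rw [← h2, ← h]
  simp

theorem halfSpace_smul {u : E n} {t : ℝ} (ht : 0 < t) (c : ℝ) :
    halfSpace (t • u) (t * c) = halfSpace u c := by
  ext x
  simp only [halfSpace, Set.mem_ofPred_eq, real_inner_smul_left]
  exact mul_le_mul_iff_of_pos_left ht

theorem IsClosedHalfSpace.exists_unit_normal {H : Set (E n)} (hH : IsClosedHalfSpace H) :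
    ∃ (u : E n) (c : ℝ), ‖u‖ = 1 ∧ H = halfSpace u c := by
  obtain ⟨u, c, hu, rfl⟩ := hH
  have hpos : 0 < ‖u‖⁻¹ := inv_pos.mpr (norm_pos_iff.mpr hu)
  exact ⟨‖u‖⁻¹ • u, ‖u‖⁻¹ * c, norm_smul_inv_norm hu, (halfSpace_smul hpos c).symm⟩

theorem closedBall_subset_halfSpace_iff {u x : E n} (hu : ‖u‖ = 1) {c d : ℝ} (hd : 0 ≤ d) :
    Metric.closedBall x d ⊆ halfSpace u c ↔ inner ℝ u x + d ≤ c := by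
  constructor
  · intro h
    have hmem : x + d • u ∈ Metric.closedBall x d := by
      simp [norm_smul, hu, abs_of_nonneg hd]
    have := mem_halfSpace.mp (h hmem)
    rwa [inner_add_right, real_inner_smul_right, real_inner_self_eq_norm_sq, hu, one_pow,
      mul_one] at this
  · intro h w hw
    rw [mem_closedBall_iff_norm] at hw
    have h1 : inner ℝ u (w - x) ≤ ‖u‖ * ‖w - x‖ := real_inner_le_norm _ _
    rw [hu, one_mul, inner_sub_right] at h1
    rw [mem_halfSpace]
    linarith

theorem infDist_halfSpace {u p : E n} (hu : ‖u‖ = 1) {c : ℝ} (hp : p ∉ halfSpace u c) :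
    Metric.infDist p (halfSpace u c) = inner ℝ u p - c := by
  have hpos : 0 < inner ℝ u p - c := by
    rw [mem_halfSpace, not_le] at hp
    linarith
  have hmem : p - (inner ℝ u p - c) • u ∈ halfSpace u c := by
    rw [mem_halfSpace, inner_sub_right, real_inner_smul_right, real_inner_self_eq_norm_sq, hu]
    linarith
  apply le_antisymm
  · refine (Metric.infDist_le_dist_of_mem hmem).trans_eq ?_
    rw [dist_eq_norm, sub_sub_cancel, norm_smul, hu, mul_one, Real.norm_of_nonneg hpos.le]
  · refine (Metric.le_infDist ⟨_, hmem⟩).mpr fun w hw => ?_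
    have h1 : inner ℝ u (p - w) ≤ ‖u‖ * ‖p - w‖ := real_inner_le_norm _ _
    rw [hu, one_mul, inner_sub_right] at h1
    rw [mem_halfSpace] at hw
    rw [dist_eq_norm]
    linarith

/-- Closed half-spaces are the sets of points at least as close to one point as to another. -/
theorem isClosedHalfSpace_iff_dist {H : Set (E n)} :
    IsClosedHalfSpace H ↔ ∃ a b : E n, a ≠ b ∧ H = {x | dist x a ≤ dist x b} := by
  have key : ∀ a b x : E n, dist x a ≤ dist x b ↔
      inner ℝ (b - a) x ≤ (‖b‖ ^ 2 - ‖a‖ ^ 2) / 2 := by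
    intro a b x
    rw [dist_eq_norm, dist_eq_norm, ← sq_le_sq₀ (norm_nonneg _) (norm_nonneg _),
      norm_sub_sq_real, norm_sub_sq_real, inner_sub_left, real_inner_comm x b,
      real_inner_comm x a]
    constructor <;> intro h <;> linarith
  constructor
  · rintro ⟨u, c, hu, rfl⟩
    have hu' : ‖u‖ ^ 2 ≠ 0 := by simpa using hu
    refine ⟨(c / ‖u‖ ^ 2 - 1 / 2) • u, (c / ‖u‖ ^ 2 + 1 / 2) • u, ?_, ?_⟩
    · intro h
      have := smul_left_injective ℝ hu h
      linarith
    · ext x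
      rw [Set.mem_ofPred_eq, Set.mem_ofPred_eq, key, ← sub_smul, norm_smul, norm_smul, mul_pow,
        mul_pow, Real.norm_eq_abs, Real.norm_eq_abs, sq_abs, sq_abs, real_inner_smul_left]
      have e : ((c / ‖u‖ ^ 2 + 1 / 2) ^ 2 * ‖u‖ ^ 2 - (c / ‖u‖ ^ 2 - 1 / 2) ^ 2 * ‖u‖ ^ 2) / 2
          = c := by
        field_simp
        ring
      rw [e]
      ring_nf
  · rintro ⟨a, b, hab, rfl⟩
    exact ⟨b - a, _, sub_ne_zero.mpr hab.symm, by ext x; exact key a b x⟩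

/-! ### Erosion and regular supporting half-spaces -/

theorem mem_erosion_iff_closedBall {X : Set (E n)} (hX : IsClosed X) {r : ℝ} (hr : 0 < r)
    {x : E n} : x ∈ erosion r X ↔ Metric.closedBall x r ⊆ X := by
  constructor
  · rintro ⟨-, hx⟩
    rw [← closure_ball x hr.ne']
    refine closure_minimal (fun w hw => ?_) hX
    by_contra hwX
    refine hx (Set.mem_biUnion (x := w) hwX ?_)
    rwa [Metric.mem_ball_comm]
  · intro h
    refine ⟨h (Metric.mem_closedBall_self hr.le), fun hx => ?_⟩
    obtain ⟨y, hy, hxy⟩ := Set.mem_iUnion₂.mp hx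
    exact hy (h (Metric.ball_subset_closedBall (Metric.mem_ball_comm.mp hxy)))

theorem mem_erosion_iff_infDist {X : Set (E n)} (hX : Xᶜ.Nonempty) {r : ℝ} (hr : 0 < r)
    {x : E n} : x ∈ erosion r X ↔ r ≤ Metric.infDist x Xᶜ := by
  rw [Metric.le_infDist hX]
  constructor
  · rintro ⟨-, hx⟩ y hy
    by_contra! hlt
    exact hx (Set.mem_biUnion hy hlt)
  · intro h
    refine ⟨?_, fun hx => ?_⟩
    · by_contra hx
      have := h hx
      rw [dist_self] at this
      linarith
    · obtain ⟨y, hy, hxy⟩ := Set.mem_iUnion₂.mp hx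
      exact (h hy).not_gt hxy

theorem exists_isSupportingAt {X : Set (E n)} (hconvex : Convex ℝ X) (hclosed : IsClosed X)
    (hint : (interior X).Nonempty) {y : E n} (hy : y ∈ frontier X) :
    ∃ H, IsSupportingAt X H y := by
  obtain ⟨f, hf⟩ := geometric_hahn_banach_open_point hconvex.interior isOpen_interior hy.2
  set u := (InnerProductSpace.toDual ℝ (E n)).symm f with hudef
  have hfu : ∀ w, f w = inner ℝ u w := fun w => by
    rw [hudef, InnerProductSpace.toDual_symm_apply]
  have hu : u ≠ 0 := by
    obtain ⟨a, ha⟩ := hint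
    intro h0
    have := hf a ha
    simp [hfu, h0] at this
  refine ⟨halfSpace u (inner ℝ u y), isClosedHalfSpace_halfSpace hu _, ?_, hy,
    (mem_frontier_halfSpace hu).mpr rfl⟩
  have hcl : IsClosed (halfSpace u (inner ℝ u y)) :=
    isClosed_le (continuous_const.inner continuous_id) continuous_const
  have hsub : interior X ⊆ halfSpace u (inner ℝ u y) := fun w hw => by
    have := (hf w hw).le
    rwa [hfu, hfu] at this
  calc X = closure X := hclosed.closure_eq.symm
    _ = closure (interior X) := (hconvex.closure_interior_eq_closure_of_nonempty_interior hint).symm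
    _ ⊆ _ := closure_minimal hsub hcl

/-- A half-space containing a closed ball with a given unit vector pointing from the centre to a
boundary point of the half-space is the tangent half-space there. -/
theorem eq_halfSpace_of_closedBall_subset {X H : Set (E n)} {x v : E n} {d : ℝ} (hd : 0 < d)
    (hv : ‖v‖ = 1) (hball : Metric.closedBall x d ⊆ X) (hH : IsSupportingAt X H (x + d • v)) :
    H = halfSpace v (inner ℝ v x + d) := by
  obtain ⟨hHs, hXH, -, hyH⟩ := hH
  obtain ⟨u, c, hu, rfl⟩ := hHs.exists_unit_normal
  have hu0 : u ≠ 0 := norm_ne_zero_iff.mp (by rw [hu]; exact one_ne_zero)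
  have h1 := (closedBall_subset_halfSpace_iff hu hd.le).mp (hball.trans hXH)
  have h2 := (mem_frontier_halfSpace hu0).mp hyH
  rw [inner_add_right, real_inner_smul_right] at h2
  have h3 : inner ℝ u v ≤ (1 : ℝ) := by
    have := real_inner_le_norm u v
    rwa [hu, hv, one_mul] at this
  have h4 : inner ℝ u v = (1 : ℝ) := by
    refine le_antisymm h3 (le_of_mul_le_mul_left ?_ hd)
    linarith
  obtain rfl := (inner_eq_one_iff_of_norm_eq_one hu hv).mp h4
  rw [h4, mul_one] at h2
  rw [h2]

/-- An inscribed ball of maximal radius about an interior point touches the boundary at a regular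
point. -/
theorem exists_isRegularSupporting_of_infDist {X : Set (E n)} (hconvex : Convex ℝ X)
    (hclosed : IsClosed X) (hX : Xᶜ.Nonempty) {x : E n} {d : ℝ} (hd : 0 < d)
    (hxd : Metric.infDist x Xᶜ = d) :
    Metric.closedBall x d ⊆ X ∧
      ∃ v : E n, ‖v‖ = 1 ∧ IsRegularSupporting X (halfSpace v (inner ℝ v x + d)) := by
  have hball : Metric.closedBall x d ⊆ X :=
    (mem_erosion_iff_closedBall hclosed hd).mp ((mem_erosion_iff_infDist hX hd).mpr hxd.ge)
  have hint : (interior X).Nonempty :=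
    ⟨x, interior_mono (Metric.ball_subset_closedBall.trans hball)
      (by rw [Metric.isOpen_ball.interior_eq]; exact Metric.mem_ball_self hd)⟩
  refine ⟨hball, ?_⟩
  obtain ⟨y, hy, hxy⟩ := isClosed_closure.exists_infDist_eq_dist hX.closure x
  rw [Metric.infDist_closure, hxd] at hxy
  have hyX : y ∈ X := hball (by rw [Metric.mem_closedBall']; exact hxy.ge)
  have hyf : y ∈ frontier X := by
    rw [frontier_eq_closure_inter_closure]
    exact ⟨subset_closure hyX, hy⟩
  set v := d⁻¹ • (y - x) with hvdef
  have hyv : y = x + d • v := by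
    rw [hvdef, smul_inv_smul₀ hd.ne', add_sub_cancel]
  have hv : ‖v‖ = 1 := by
    rw [hvdef, norm_smul, norm_inv, Real.norm_of_nonneg hd.le, ← dist_eq_norm, dist_comm, ← hxy,
      inv_mul_cancel₀ hd.ne']
  have huniq : ∀ H, IsSupportingAt X H y → H = halfSpace v (inner ℝ v x + d) := fun H hH =>
    eq_halfSpace_of_closedBall_subset hd hv hball (hyv ▸ hH)
  obtain ⟨H, hH⟩ := exists_isSupportingAt hconvex hclosed hint hyf
  obtain rfl := huniq H hH
  exact ⟨v, hv, y, ⟨hyf, _, hH, huniq⟩, hH⟩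

theorem IsRegularSupporting.isSupporting {X H : Set (E n)} (h : IsRegularSupporting X H) :
    IsSupporting X H := h.imp fun _ hx => hx.2

theorem IsSupporting.subset {X H : Set (E n)} (h : IsSupporting X H) : X ⊆ H := by
  obtain ⟨x, hx⟩ := h
  exact hx.2.1

/-- A closed convex set with nonempty interior is the intersection of its regular supporting
half-spaces. -/
theorem mem_iff_forall_isRegularSupporting {X : Set (E n)} (hconvex : Convex ℝ X)
    (hclosed : IsClosed X) (hint : (interior X).Nonempty) {z : E n} :
    z ∈ X ↔ ∀ H, IsRegularSupporting X H → z ∈ H := by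
  refine ⟨fun hz H hH => hH.isSupporting.subset hz, fun hz => ?_⟩
  by_contra hzX
  have hX : Xᶜ.Nonempty := ⟨z, hzX⟩
  obtain ⟨a, ha⟩ := hint
  obtain ⟨ρ, hρ, hρX⟩ := Metric.isOpen_iff.mp isOpen_interior a ha
  have haX : Metric.ball a ρ ⊆ X := hρX.trans interior_subset
  have haρ : a ∈ erosion ρ X := by
    rw [mem_erosion_iff_closedBall hclosed hρ, ← closure_ball a hρ.ne']
    exact closure_minimal haX hclosed
  set γ : ℝ → E n := fun t => AffineMap.lineMap a z t with hγ
  have hγc : Continuous γ := AffineMap.lineMap_continuous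
  have hev : ∀ᶠ t in nhdsWithin (1 : ℝ) (Set.Iio 1), γ t ∈ Xᶜ := by
    have h1 : γ 1 ∈ Xᶜ := by simpa [hγ] using hzX
    exact (hγc.continuousAt.eventually (hclosed.isOpen_compl.mem_nhds h1)).filter_mono
      nhdsWithin_le_nhds
  have hev0 : ∀ᶠ t in nhdsWithin (1 : ℝ) (Set.Iio 1), (0 : ℝ) < t :=
    (lt_mem_nhds one_pos).filter_mono nhdsWithin_le_nhds
  obtain ⟨s, ⟨hsX, hs0⟩, hs1⟩ := ((hev.and hev0).and self_mem_nhdsWithin).exists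
  -- At a zero of `g`, the tangent half-space contains `z` and the `ρ`-ball about `a`, hence the
  -- ball of radius `(1 - t) * ρ` about `γ t`. The factor `1 / 2` makes this exceed the inscribed
  -- radius.
  set g : ℝ → ℝ := fun t => Metric.infDist (γ t) Xᶜ - (1 - t) * (ρ / 2) with hg
  have hgc : Continuous g := by
    have := (Metric.continuous_infDist_pt Xᶜ).comp hγc
    exact this.sub (by fun_prop)
  have hg0 : 0 ≤ g 0 := by
    have := (mem_erosion_iff_infDist hX hρ).mp haρ
    simp only [hg, hγ, AffineMap.lineMap_apply_zero]
    linarith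
  have hgs : g s ≤ 0 := by
    simp only [hg, Metric.infDist_zero_of_mem hsX]
    nlinarith
  obtain ⟨t, ht, hgt⟩ := intermediate_value_Icc' hs0.le hgc.continuousOn ⟨hgs, hg0⟩
  have ht1 : 0 < 1 - t := by linarith [ht.2]
  have hdpos : 0 < (1 - t) * (ρ / 2) := by positivity
  have hd : Metric.infDist (γ t) Xᶜ = (1 - t) * (ρ / 2) := sub_eq_zero.mp hgt
  obtain ⟨-, v, hv, hreg⟩ :=
    exists_isRegularSupporting_of_infDist hconvex hclosed hX hdpos hd
  have h1 := mem_halfSpace.mp (hz _ hreg)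
  have h2 := (closedBall_subset_halfSpace_iff hv hρ.le).mp
    (((mem_erosion_iff_closedBall hclosed hρ).mp haρ).trans hreg.isSupporting.subset)
  have h3 : inner ℝ v (γ t) = (1 - t) * inner ℝ v a + t * inner ℝ v z := by
    simp only [hγ, AffineMap.lineMap_apply_module, inner_add_right, real_inner_smul_right]
  have h4 := mul_le_mul_of_nonneg_left h1 ht.1
  have h5 := mul_le_mul_of_nonneg_left h2 ht1.le
  have h6 : 0 < (1 - t) * ρ := by positivity
  nlinarith

/-- A regular supporting half-space of the erosion is a regular supporting half-space of the set,
moved inwards by the erosion radius. -/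
theorem IsRegularSupporting.of_erosion {X H : Set (E n)} (hconvex : Convex ℝ X)
    (hclosed : IsClosed X) {r : ℝ} (hr : 0 < r) (hH : IsRegularSupporting (erosion r X) H) :
    ∃ (v : E n) (c : ℝ), ‖v‖ = 1 ∧ H = halfSpace v c ∧
      IsRegularSupporting X (halfSpace v (c + r)) := by
  obtain ⟨x, ⟨hxf, H', -, hH'⟩, hxH⟩ := hH
  have hX : Xᶜ.Nonempty := by
    rw [Set.nonempty_compl]
    rintro rfl
    simp [erosion] at hxf
  have heq : erosion r X = {x | r ≤ Metric.infDist x Xᶜ} := by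
    ext w; exact mem_erosion_iff_infDist hX hr
  have hxr : Metric.infDist x Xᶜ = r := by
    rw [heq] at hxf
    exact (frontier_le_subset_eq continuous_const (Metric.continuous_infDist_pt Xᶜ) hxf).symm
  obtain ⟨-, v, hv, hreg⟩ := exists_isRegularSupporting_of_infDist hconvex hclosed hX hr hxr
  have hv0 : v ≠ 0 := norm_ne_zero_iff.mp (by rw [hv]; exact one_ne_zero)
  refine ⟨v, inner ℝ v x, hv, ?_, hreg⟩
  -- The tangent half-space moved inwards by `r` also supports the erosion at `x`, so regularity of
  -- `x` identifies it with `H`.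
  refine (hH' H hxH).trans (hH' _ ⟨isClosedHalfSpace_halfSpace hv0 _, fun w hw => ?_, hxf,
    (mem_frontier_halfSpace hv0).mpr rfl⟩).symm
  have := (closedBall_subset_halfSpace_iff hv hr.le).mp
    (((mem_erosion_iff_closedBall hclosed hr).mp hw).trans hreg.isSupporting.subset)
  rw [mem_halfSpace]
  linarith

/-! ### Similarity transformations -/

theorem IsClosedHalfSpace.image {H : Set (E n)} (hH : IsClosedHalfSpace H) (σ : E n ≃ᵈ E n) :
    IsClosedHalfSpace (σ '' H) := by
  obtain ⟨a, b, hab, rfl⟩ := isClosedHalfSpace_iff_dist.mp hH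
  refine isClosedHalfSpace_iff_dist.mpr ⟨σ a, σ b, σ.injective.ne hab, ?_⟩
  ext y
  obtain ⟨x, rfl⟩ := σ.surjective y
  rw [σ.injective.mem_set_image, Set.mem_ofPred_eq, Set.mem_ofPred_eq, Dilation.dist_eq,
    Dilation.dist_eq, mul_le_mul_iff_of_pos_left]
  exact_mod_cast Dilation.ratio_pos σ

theorem image_frontier (σ : E n ≃ᵈ E n) (s : Set (E n)) :
    σ '' frontier s = frontier (σ '' s) :=
  σ.toHomeomorph.image_frontier s

theorem IsSupportingAt.image {X H : Set (E n)} {x : E n} (h : IsSupportingAt X H x)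
    (σ : E n ≃ᵈ E n) : IsSupportingAt (σ '' X) (σ '' H) (σ x) :=
  ⟨h.1.image σ, Set.image_mono h.2.1, image_frontier σ X ▸ Set.mem_image_of_mem σ h.2.2.1,
    image_frontier σ H ▸ Set.mem_image_of_mem σ h.2.2.2⟩

theorem symm_image_image (σ : E n ≃ᵈ E n) (s : Set (E n)) : σ.symm '' (σ '' s) = s :=
  σ.toEquiv.symm_image_image s

theorem image_symm_image (σ : E n ≃ᵈ E n) (s : Set (E n)) : σ '' (σ.symm '' s) = s :=
  σ.toEquiv.image_symm_image s

theorem IsRegularSupporting.image {X H : Set (E n)} (h : IsRegularSupporting X H)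
    (σ : E n ≃ᵈ E n) : IsRegularSupporting (σ '' X) (σ '' H) := by
  obtain ⟨x, ⟨hxf, K, hK, hK'⟩, hxH⟩ := h
  refine ⟨σ x, ⟨image_frontier σ X ▸ Set.mem_image_of_mem σ hxf, σ '' K, hK.image σ,
    fun L hL => ?_⟩, hxH.image σ⟩
  have := hL.image σ.symm
  rw [symm_image_image, σ.symm_apply_apply] at this
  rw [← hK' _ this, image_symm_image]

theorem DistanceIncreasing.exists_ratio {σ : E n ≃ᵈ E n} (hσ : DistanceIncreasing σ) :
    ∃ l : ℝ, 1 < l ∧ ∀ x y, dist (σ x) (σ y) = l * dist x y := by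
  rcases subsingleton_or_nontrivial (E n) with h | h
  -- For `n = 0` any ratio is valid; `2` is an arbitrary choice above `1`.
  · refine ⟨2, one_lt_two, fun x y => ?_⟩
    rw [Subsingleton.elim x y, dist_self, dist_self, mul_zero]
  · obtain ⟨x, y, hxy⟩ := exists_pair_ne (E n)
    refine ⟨Dilation.ratio σ, ?_, Dilation.dist_eq σ⟩
    have := hσ x y hxy
    rw [Dilation.dist_eq] at this
    exact (lt_mul_iff_one_lt_left (dist_pos.mpr hxy)).mp this

theorem exists_unique_fixedPoint {σ : E n ≃ᵈ E n} {l : ℝ} (hl : 1 < l)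
    (hσ : ∀ x y, dist (σ x) (σ y) = l * dist x y) : ∃ p, ∀ q, σ q = q ↔ q = p := by
  have hl0 : 0 < l := one_pos.trans hl
  have hlip : LipschitzWith (Real.toNNReal l⁻¹) σ.symm := by
    refine LipschitzWith.of_dist_le_mul fun x y => ?_
    have := hσ (σ.symm x) (σ.symm y)
    rw [σ.apply_symm_apply, σ.apply_symm_apply] at this
    rw [this, Real.coe_toNNReal _ (inv_pos.mpr hl0).le, inv_mul_cancel_left₀ hl0.ne']
  have hc : ContractingWith (Real.toNNReal l⁻¹) σ.symm := by
    refine ⟨?_, hlip⟩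
    rw [Real.toNNReal_lt_one]
    exact inv_lt_one_of_one_lt₀ hl
  have hp : σ (hc.fixedPoint) = hc.fixedPoint := by
    have h : σ.symm hc.fixedPoint = hc.fixedPoint := hc.fixedPoint_isFixedPt
    conv_lhs => rw [← h]
    exact σ.apply_symm_apply _
  refine ⟨hc.fixedPoint, fun q => ⟨fun hq => ?_, fun hq => hq ▸ hp⟩⟩
  refine hc.fixedPoint_unique ?_
  change σ.symm q = q
  conv_lhs => rw [← hq]
  exact σ.symm_apply_apply q

theorem dist_iterate {σ : E n → E n} {l : ℝ} (hσ : ∀ x y, dist (σ x) (σ y) = l * dist x y)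
    (k : ℕ) (x y : E n) : dist (σ^[k] x) (σ^[k] y) = l ^ k * dist x y := by
  induction k with
  | zero => simp
  | succ k ih => rw [Function.iterate_succ_apply', Function.iterate_succ_apply', hσ, ih, pow_succ']
                 ring

/-- Orbits of a similarity transformation, rescaled about its fixed point, are recurrent. -/
theorem exists_iterate_near {σ : E n → E n} {l : ℝ} (hl : 1 < l)
    (hσ : ∀ x y, dist (σ x) (σ y) = l * dist x y) {p : E n} (hp : σ p = p) (x : E n) {ε : ℝ}
    (hε : 0 < ε) : ∃ k : ℕ, 0 < k ∧ ‖(l ^ k)⁻¹ • (σ^[k] x - p) - (x - p)‖ < ε := by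
  have hl0 : 0 < l := one_pos.trans hl
  have hpk : ∀ k, σ^[k] p = p := fun k => Function.iterate_fixed hp k
  set y : ℕ → E n := fun k => (l ^ k)⁻¹ • (σ^[k] x - p) with hy
  have hnormσ : ∀ k (a : E n), ‖σ^[k] a - p‖ = l ^ k * ‖a - p‖ := by
    intro k a
    have := dist_iterate hσ k a p
    rwa [hpk, dist_eq_norm, dist_eq_norm] at this
  have hinner : ∀ k (a b : E n),
      inner ℝ (σ^[k] a - p) (σ^[k] b - p) = (l ^ k) ^ 2 * inner ℝ (a - p) (b - p) := by
    intro k a b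
    have h := dist_iterate hσ k a b
    rw [dist_eq_norm, dist_eq_norm, ← sub_sub_sub_cancel_right _ _ p,
      ← sub_sub_sub_cancel_right a b p] at h
    have h1 := norm_sub_sq_real (σ^[k] a - p) (σ^[k] b - p)
    have h2 := norm_sub_sq_real (a - p) (b - p)
    rw [h, hnormσ, hnormσ, mul_pow, h2] at h1
    linarith
  have hnorm : ∀ k, ‖y k‖ = ‖x - p‖ := by
    intro k
    rw [hy, norm_smul, hnormσ, norm_inv, Real.norm_of_nonneg (by positivity),
      inv_mul_cancel_left₀ (by positivity)]
  -- The rescaled orbit is bounded, so two of its terms, `y m` and `y (m + (k + 1))`, are close.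
  -- Rescaled `σ` is an isometry about `p`, so cancelling `m` steps keeps the distance.
  obtain ⟨a, -, φ, hφ, hlim⟩ := (isCompact_closedBall (0 : E n) ‖x - p‖).tendsto_subseq
    (x := y) (fun k => by rw [mem_closedBall_zero_iff, hnorm])
  obtain ⟨N, hN⟩ := Metric.cauchySeq_iff.mp hlim.cauchySeq ε hε
  have hlt := hφ (Nat.lt_succ_self N)
  have hdist := hN (N + 1) (Nat.le_succ N) N le_rfl
  obtain ⟨k, hk⟩ := Nat.exists_eq_add_of_lt hlt
  set m := φ N with hm
  refine ⟨k + 1, Nat.succ_pos k, ?_⟩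
  have hk' : φ (N + 1) = m + (k + 1) := by rw [← add_assoc]; exact hk
  have hin : inner ℝ (y (m + (k + 1))) (y m) = inner ℝ (y (k + 1)) (x - p) := by
    simp only [hy, real_inner_smul_left, real_inner_smul_right]
    rw [Function.iterate_add_apply, hinner, pow_add]
    have : l ^ m ≠ 0 := by positivity
    have : l ^ (k + 1) ≠ 0 := by positivity
    field_simp
  have h1 := norm_sub_sq_real (y (m + (k + 1))) (y m)
  have h2 := norm_sub_sq_real (y (k + 1)) (x - p)
  rw [hnorm, hnorm, hin] at h1
  rw [hnorm, ← h1, sq_eq_sq₀ (norm_nonneg _) (norm_nonneg _)] at h2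
  simp only [Function.comp_apply, hk', ← hm, dist_eq_norm] at hdist
  rw [h2]
  exact hdist

/-! ### From a similar erosion to an exscribed ball -/

/-- Applying `σ` scales a ball inside `X` by `l` and lands it in the erosion, which leaves room for
a further `r`. The radius solves `s ↦ l * s + r` started at `0`. -/
theorem closedBall_iterate_subset {X : Set (E n)} (hclosed : IsClosed X) {r l : ℝ}
    {σ : E n ≃ᵈ E n} (hr : 0 < r) (hl : 1 < l) (hσ : ∀ x y, dist (σ x) (σ y) = l * dist x y)
    (hX : erosion r X = σ '' X) {x : E n} (hx : x ∈ X) (k : ℕ) :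
    Metric.closedBall (σ^[k] x) (r / (l - 1) * (l ^ k - 1)) ⊆ X := by
  have hl0 : 0 < l := one_pos.trans hl
  have hl1 : 0 < l - 1 := sub_pos.mpr hl
  induction k with
  | zero => simpa using hx
  | succ k ih =>
    intro w hw
    have hs : 0 ≤ r / (l - 1) * (l ^ k - 1) :=
      mul_nonneg (by positivity) (sub_nonneg.mpr (one_le_pow₀ hl.le))
    rw [Metric.mem_closedBall, Function.iterate_succ_apply'] at hw
    have e : r / (l - 1) * (l ^ (k + 1) - 1) = l * (r / (l - 1) * (l ^ k - 1)) + r := by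
      field_simp
      ring
    rw [e] at hw
    obtain ⟨z, hz1, hz2⟩ := exists_dist_le_le hr.le (mul_nonneg hl0.le hs) hw
    obtain ⟨z, rfl⟩ := σ.surjective z
    rw [hσ, mul_le_mul_iff_of_pos_left hl0] at hz2
    have hz : σ z ∈ erosion r X := hX ▸ Set.mem_image_of_mem σ (ih hz2)
    exact (mem_erosion_iff_closedBall hclosed hr).mp hz hz1

theorem notMem_and_le_infDist_of_isSupporting {X : Set (E n)} (hclosed : IsClosed X) {r l : ℝ}
    {σ : E n ≃ᵈ E n} (hr : 0 < r) (hl : 1 < l) (hσ : ∀ x y, dist (σ x) (σ y) = l * dist x y)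
    (hX : erosion r X = σ '' X) {p : E n} (hp : σ p = p) {H : Set (E n)}
    (hH : IsSupporting X H) : p ∉ H ∧ r / (l - 1) ≤ Metric.infDist p H := by
  obtain ⟨x, hHs, hXH, hxX, hxH⟩ := hH
  obtain ⟨v, c, hv, rfl⟩ := hHs.exists_unit_normal
  have hv0 : v ≠ 0 := norm_ne_zero_iff.mp (by rw [hv]; exact one_ne_zero)
  have hx : x ∈ X := hclosed.frontier_subset hxX
  have hc := (mem_frontier_halfSpace hv0).mp hxH
  have hl1 : 0 < l - 1 := sub_pos.mpr hl
  have hR : 0 < r / (l - 1) := by positivity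
  have key : r / (l - 1) ≤ inner ℝ v p - c := by
    by_contra! hlt
    set R := r / (l - 1) with hRdef
    -- Dividing the ball inclusion by `l ^ k` shrinks `c - inner ℝ v p + R` at least by the factor
    -- `l⁻¹`; a recurrence error below this gap is contradictory.
    have hpos : 0 < (c - inner ℝ v p + R) * (1 - l⁻¹) :=
      mul_pos (by linarith) (sub_pos.mpr (inv_lt_one_of_one_lt₀ hl))
    obtain ⟨k, hk, hnear⟩ := exists_iterate_near hl hσ hp x hpos
    have hlk : 0 < l ^ k := by positivity
    have h1 := (closedBall_subset_halfSpace_iff hv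
      (mul_nonneg hR.le (sub_nonneg.mpr (one_le_pow₀ hl.le)))).mp
      ((closedBall_iterate_subset hclosed hr hl hσ hX hx k).trans hXH)
    have h2 := neg_le_of_abs_le (abs_real_inner_le_norm v ((l ^ k)⁻¹ • (σ^[k] x - p) - (x - p)))
    rw [hv, one_mul, inner_sub_right, real_inner_smul_right, inner_sub_right, inner_sub_right,
      hc] at h2
    have h3 : (l ^ k)⁻¹ * (inner ℝ v (σ^[k] x) - inner ℝ v p) + R
        ≤ (l ^ k)⁻¹ * (c - inner ℝ v p + R) := by
      have e : (l ^ k)⁻¹ * (inner ℝ v (σ^[k] x) - inner ℝ v p) + R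
          = (l ^ k)⁻¹ * (inner ℝ v (σ^[k] x) - inner ℝ v p + R * l ^ k) := by
        field_simp
      rw [e]
      refine mul_le_mul_of_nonneg_left ?_ (by positivity)
      linarith
    have h4 : (l ^ k)⁻¹ * (c - inner ℝ v p + R) ≤ l⁻¹ * (c - inner ℝ v p + R) := by
      refine mul_le_mul_of_nonneg_right ?_ (by linarith)
      exact inv_anti₀ (by linarith) (le_self_pow₀ hl.le hk.ne')
    linarith
  have hpH : p ∉ halfSpace v c := by
    rw [mem_halfSpace]
    linarith
  exact ⟨hpH, (infDist_halfSpace hv hpH).symm ▸ key⟩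

theorem infDist_image {σ : E n ≃ᵈ E n} {l : ℝ} (hl : 0 < l)
    (hσ : ∀ x y, dist (σ x) (σ y) = l * dist x y) {p : E n} (hp : σ p = p) {H : Set (E n)}
    (hH : H.Nonempty) : Metric.infDist p (σ '' H) = l * Metric.infDist p H := by
  apply le_antisymm
  · rw [← div_le_iff₀' hl]
    refine (Metric.le_infDist hH).mpr fun y hy => ?_
    rw [div_le_iff₀' hl, ← hσ, hp]
    exact Metric.infDist_le_dist_of_mem (Set.mem_image_of_mem σ hy)
  · refine (Metric.le_infDist (hH.image σ)).mpr ?_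
    rintro _ ⟨y, hy, rfl⟩
    have := hσ p y
    rw [hp] at this
    rw [this]
    exact mul_le_mul_of_nonneg_left (Metric.infDist_le_dist_of_mem hy) hl.le

theorem exists_isRegularSupporting_infDist {X : Set (E n)} (hconvex : Convex ℝ X)
    (hclosed : IsClosed X) (hne : X.Nonempty) {r l : ℝ} {σ : E n ≃ᵈ E n} (hr : 0 < r)
    (hl : 1 < l) (hσ : ∀ x y, dist (σ x) (σ y) = l * dist x y) (hX : erosion r X = σ '' X)
    {p : E n} (hp : σ p = p) {H : Set (E n)} (hH : IsRegularSupporting X H) :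
    ∃ H', IsRegularSupporting X H' ∧ Metric.infDist p H' = l * Metric.infDist p H - r := by
  have hreg := hH.image σ
  rw [← hX] at hreg
  obtain ⟨v, c, hv, hσH, hreg'⟩ := hreg.of_erosion hconvex hclosed hr
  refine ⟨_, hreg', ?_⟩
  have hpH' := (notMem_and_le_infDist_of_isSupporting hclosed hr hl hσ hX hp
    hreg'.isSupporting).1
  have hpH : p ∉ halfSpace v c := by
    rw [mem_halfSpace] at hpH' ⊢
    linarith
  rw [← infDist_image (one_pos.trans hl) hσ hp (hne.mono hH.isSupporting.subset), hσH,
    infDist_halfSpace hv hpH', infDist_halfSpace hv hpH]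
  ring

theorem isExscribedBall_of_erosion_eq_image {X : Set (E n)} (hconvex : Convex ℝ X)
    (hclosed : IsClosed X) (hne : X.Nonempty) {r l : ℝ} {σ : E n ≃ᵈ E n} (hr : 0 < r)
    (hl : 1 < l) (hσ : ∀ x y, dist (σ x) (σ y) = l * dist x y) (hX : erosion r X = σ '' X)
    {p : E n} (hp : σ p = p) : IsExscribedBall X p (r / (l - 1)) := by
  have hl1 : 0 < l - 1 := sub_pos.mpr hl
  refine ⟨by positivity, fun H hH => ?_⟩
  have hiter : ∀ k : ℕ, ∃ K, IsRegularSupporting X K ∧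
      Metric.infDist p K - r / (l - 1) = l ^ k * (Metric.infDist p H - r / (l - 1)) := by
    intro k
    induction k with
    | zero => exact ⟨H, hH, by simp⟩
    | succ k ih =>
      obtain ⟨K, hK, hKd⟩ := ih
      obtain ⟨K', hK', hKd'⟩ :=
        exists_isRegularSupporting_infDist hconvex hclosed hne hr hl hσ hX hp hK
      refine ⟨K', hK', ?_⟩
      rw [pow_succ', mul_assoc, ← hKd, hKd']
      field_simp
      ring
  refine le_antisymm ?_
    (notMem_and_le_infDist_of_isSupporting hclosed hr hl hσ hX hp hH.isSupporting).2
  by_contra! hlt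
  obtain ⟨a, ha⟩ := hne
  have hpos : 0 < Metric.infDist p H - r / (l - 1) := sub_pos.mpr hlt
  obtain ⟨k, hk⟩ := pow_unbounded_of_one_lt (dist p a / (Metric.infDist p H - r / (l - 1))) hl
  rw [div_lt_iff₀ hpos] at hk
  obtain ⟨K, hK, hKd⟩ := hiter k
  have h1 : Metric.infDist p K ≤ dist p a :=
    Metric.infDist_le_dist_of_mem (hK.isSupporting.subset ha)
  have h2 : 0 < r / (l - 1) := by positivity
  linarith

theorem exists_erosion_eq_image_of_isExscribedBall {X : Set (E n)} (hconvex : Convex ℝ X)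
    (hclosed : IsClosed X) (hint : (interior X).Nonempty) {p : E n} {R : ℝ}
    (hR : IsExscribedBall X p R) :
    ∃ σ : E n ≃ᵈ E n, DistanceIncreasing σ ∧ erosion R X = σ '' X := by
  obtain ⟨hR0, hR⟩ := hR
  -- Ratio `2` is the one for which `r / (l - 1) = R` holds with `r = R`.
  set σ : E n ≃ᵈ E n := DilationEquiv.smulTorsor (-p) (two_ne_zero (α := ℝ))
  have hσ : ∀ x, σ x = (2 : ℝ) • x - p := fun x => (sub_eq_add_neg _ _).symm
  refine ⟨σ, fun x y hxy => ?_, ?_⟩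
  · rw [hσ, hσ, dist_sub_right, dist_smul₀, Real.norm_two]
    linarith [dist_pos.mpr hxy]
  · ext w
    obtain ⟨x, rfl⟩ := σ.surjective w
    have hball : Metric.closedBall (σ x) R ⊆ X ↔
        ∀ H, IsRegularSupporting X H → Metric.closedBall (σ x) R ⊆ H :=
      ⟨fun h H hH => h.trans hH.isSupporting.subset, fun h _ hy =>
        (mem_iff_forall_isRegularSupporting hconvex hclosed hint).mpr fun H hH => h H hH hy⟩
    rw [σ.injective.mem_set_image, mem_erosion_iff_closedBall hclosed hR0, hball,
      mem_iff_forall_isRegularSupporting hconvex hclosed hint]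
    refine forall₂_congr fun H hH => ?_
    have hd := hR H hH
    have hpH : p ∉ H := fun hp => by
      rw [Metric.infDist_zero_of_mem hp] at hd
      exact hR0.ne hd
    obtain ⟨v, c, hv, rfl⟩ : ∃ (u : E n) (c : ℝ), ‖u‖ = 1 ∧ H = halfSpace u c := by
      obtain ⟨y, -, hy⟩ := hH
      exact hy.1.exists_unit_normal
    rw [infDist_halfSpace hv hpH] at hd
    rw [closedBall_subset_halfSpace_iff hv hR0.le, mem_halfSpace, hσ, inner_sub_right,
      real_inner_smul_right]
    constructor <;> intro h <;> linarith

end ErosionResilient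

theorem mainTheorem4 (n : ℕ) (X : Set (ErosionResilient.E n))
    (hclosed : IsClosed X) (hconvex : Convex ℝ X) (hint : (interior X).Nonempty) :
    ((∃ (r : ℝ) (σ : ErosionResilient.E n ≃ᵈ ErosionResilient.E n),
        0 < r ∧ ErosionResilient.DistanceIncreasing σ ∧
          ErosionResilient.erosion r X = σ '' X) ↔
      ErosionResilient.HasExscribedBall X) ∧
    (∀ (r : ℝ) (σ : ErosionResilient.E n ≃ᵈ ErosionResilient.E n),
      0 < r → ErosionResilient.DistanceIncreasing σ →
      ErosionResilient.erosion r X = σ '' X →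
      ∃ p : ErosionResilient.E n,
        (∀ q : ErosionResilient.E n, σ q = q ↔ q = p) ∧
        (∀ H : Set (ErosionResilient.E n), ErosionResilient.IsSupporting X H → p ∉ H) ∧
        ∃ R : ℝ, ErosionResilient.IsExscribedBall X p R) := by
  have hforward : ∀ (r : ℝ) (σ : ErosionResilient.E n ≃ᵈ ErosionResilient.E n),
      0 < r → ErosionResilient.DistanceIncreasing σ →
      ErosionResilient.erosion r X = σ '' X →
      ∃ p : ErosionResilient.E n,
        (∀ q : ErosionResilient.E n, σ q = q ↔ q = p) ∧
        (∀ H : Set (ErosionResilient.E n), ErosionResilient.IsSupporting X H → p ∉ H) ∧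
        ∃ R : ℝ, ErosionResilient.IsExscribedBall X p R := by
    intro r σ hr hσ hX
    obtain ⟨l, hl, hdist⟩ := hσ.exists_ratio
    obtain ⟨p, hp⟩ := ErosionResilient.exists_unique_fixedPoint hl hdist
    have hpp := (hp p).mpr rfl
    exact ⟨p, hp, fun H hH => (ErosionResilient.notMem_and_le_infDist_of_isSupporting hclosed hr
      hl hdist hX hpp hH).1, _, ErosionResilient.isExscribedBall_of_erosion_eq_image hconvex
      hclosed (hint.mono interior_subset) hr hl hdist hX hpp⟩
  refine ⟨⟨?_, ?_⟩, hforward⟩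
  · rintro ⟨r, σ, hr, hσ, hX⟩
    obtain ⟨p, -, -, R, hR⟩ := hforward r σ hr hσ hX
    exact ⟨p, R, hR⟩
  · rintro ⟨p, R, hR⟩
    obtain ⟨σ, hσ, hX⟩ :=
      ErosionResilient.exists_erosion_eq_image_of_isExscribedBall hconvex hclosed hint hR
    exact ⟨R, σ, hR.1, hσ, hX⟩
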